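/- Let $\mathbb V$ be a Euclidean space (a finite-dimensional real inner product space) and let $\mathbb X,\mathbb Y$ be Euclidean Jordan algebras, i.e. Euclidean spaces with a bilinear commutative product $\circ$ that satisfies $x\circ((x\circ x)\circ y)=(x\circ x)\circ(x\circ y)$, has a unit element, and satisfies $\langle x\circ y,z\rangle=\langle y,x\circ z\rangle$ for all $x,y,z$. Let $K_{\mathbb X}=\{z\circ z: z\in\mathbb X\}$ and $K_{\mathbb Y}=\{z\circ z:z\in\mathbb Y\}$ be their symmetric cones. For a set $K$ in a Euclidean space, $K^*=\{\zeta:\langle \zeta,w\rangle\ge 0\ \text{for all } w\in K\}$ denotes its dual cone. Let $P,Q\subseteq\mathbb V$ be closed convex cones, each different from $\{0\}$ and from $\mathbb V$. Let $G:\mathbb X\to\mathbb V$ and $H:\mathbb Y\to\mathbb V$ be linear maps such that $P=G(K_{\mathbb X})$ and $Q=H(K_{\mathbb Y})$ are LISC cones, that is: $P\cap(-P)=\{0\}$, $Q\cap(-Q)=\{0\}$, $G(c)\neq0$ for every primitive idempotent $c\in\mathbb X$, and $H(c)\ne0$ for every primitive idempotent $c\in\mathbb Y$. (An idempotent, $c\circ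 c=c$, is primitive if it is nonzero and is not a sum of two nonzero idempotents.) A pair $(u,v)\in\mathbb V\times\mathbb V$ is an *antipodal pair* of $(P,Q)$ if it minimizes $\langle u,v\rangle$ subject to $u\in P$, $\|u\|=1$, $v\in Q$, $\|v\|=1$. It is a *critical pair* of $(P,Q)$ if $u\in P$, $\|u\|=1$, $v\in Q$, $\|v\|=1$, $v-\langle u,v\rangle u\in P^*$ and $u-\langle u,v\rangle v\in Q^*$. Consider the problem $$(\ast)\qquad \min\ \Psi(x,y):=\langle Gx,Hy\rangle\quad\text{s.t.}\quad x\in K_{\mathbb X},\ \phi_1(x):=\|Gx\|-1=0,\quad y\in K_{\mathbb Y},\ \phi_2(y):=\|Hy\|-1=0.$$ A *solution* of $(\ast)$ is a feasible point at which $\Psi$ attains its minimum over the feasible set. A *stationary point* of $(\ast)$ is a feasible point $(\bar x,\bar y)$ for which there are $\gamma_1,\gamma_2\in\mathbb R$ such that $$\nabla_x\Psi(\bar x,\bar y)+\gamma_1\nabla\phi_1(\bar x)\in K_{\mathbb X}^*\ \text{ is orthogonal to }\bar x,\qquad \nabla_y\Psi(\bar x,\bar y)+\gamma_2\nabla\phi_2(\bar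 y)\in K_{\mathbb Y}^*\ \text{ is orthogonal to }\bar y.$$ If $(\bar x,\bar y)$ is a stationary point (resp. solution) of $(\ast)$, then $(G\bar x,H\bar y)$ is a critical (resp. antipodal) pair of $(P,Q)$. Conversely, if $(u,v)$ is a critical (resp. antipodal) pair of $(P,Q)$, then there exists a stationary point (resp. solution) $(\bar x,\bar y)$ of $(\ast)$ such that $u=G\bar x$ and $v=H\bar y$. -/

import Mathlib

open scoped Gradient

namespace ConeAngles

/-- A Euclidean Jordan algebra: a finite-dimensional real inner product space with a bilinear
commutative product satisfying the Jordan identity, having a unit, and for which the inner product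
is associative. -/
class EuclideanJordanAlgebra (X : Type*) [NormedAddCommGroup X] [InnerProductSpace ℝ X]
    [FiniteDimensional ℝ X] where
  /-- the Jordan product -/
  jmul : X →ₗ[ℝ] X →ₗ[ℝ] X
  /-- the unit element -/
  e : X
  jmul_comm : ∀ x y, jmul x y = jmul y x
  jordan_identity : ∀ x y, jmul x (jmul (jmul x x) y) = jmul (jmul x x) (jmul x y)
  e_jmul : ∀ x, jmul e x = x
  inner_jmul : ∀ x y z, inner ℝ (jmul x y) z = inner ℝ y (jmul x z)

section Jordan

variable (X : Type*) [NormedAddCommGroup X] [InnerProductSpace ℝ X] [FiniteDimensional ℝ X]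
  [EuclideanJordanAlgebra X]

/-- The symmetric cone of `X`: the cone of squares. -/
def symmetricCone : Set X :=
  {x | ∃ z : X, x = EuclideanJordanAlgebra.jmul z z}

variable {X}

/-- Idempotents of `X`. -/
def IsIdempotent (c : X) : Prop := EuclideanJordanAlgebra.jmul c c = c

/-- Primitive idempotents: nonzero, and not a sum of two nonzero idempotents. -/
def IsPrimitiveIdempotent (c : X) : Prop :=
  IsIdempotent c ∧ c ≠ 0 ∧
    ¬ ∃ a b : X, IsIdempotent a ∧ IsIdempotent b ∧ a ≠ 0 ∧ b ≠ 0 ∧ c = a + b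

/-- The closed convex cone `P` is a LISC cone, represented as `P = G(K)` with `K` the symmetric
cone of `X`: no primitive idempotent is sent to zero, and `P` is pointed. -/
structure IsLISC {V : Type*} [NormedAddCommGroup V] [InnerProductSpace ℝ V]
    (P : ProperCone ℝ V) (G : X →ₗ[ℝ] V) : Prop where
  image_eq : G '' symmetricCone X = (P : Set V)
  map_ne_zero : ∀ c : X, IsPrimitiveIdempotent c → G c ≠ 0
  pointed : ∀ u : V, u ∈ P → -u ∈ P → u = 0

end Jordan

/-- The problem of minimizing `Ψ (x, y)` subject to `x ∈ K`, `φ₁ x = 0`, `y ∈ L`, `φ₂ y = 0`,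
where `Ψ`, `φ₁`, `φ₂` are differentiable at the feasible points. -/
structure ConicProblem (X Y : Type*) [NormedAddCommGroup X] [InnerProductSpace ℝ X]
    [NormedAddCommGroup Y] [InnerProductSpace ℝ Y] where
  K : Set X
  L : Set Y
  Ψ : X × Y → ℝ
  φ₁ : X → ℝ
  φ₂ : Y → ℝ
  differentiableAt_Ψ : ∀ x ∈ K, ∀ y ∈ L, φ₁ x = 0 → φ₂ y = 0 → DifferentiableAt ℝ Ψ (x, y)
  differentiableAt_φ₁ : ∀ x ∈ K, φ₁ x = 0 → DifferentiableAt ℝ φ₁ x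
  differentiableAt_φ₂ : ∀ y ∈ L, φ₂ y = 0 → DifferentiableAt ℝ φ₂ y

namespace ConicProblem

variable {X Y : Type*} [NormedAddCommGroup X] [InnerProductSpace ℝ X]
  [NormedAddCommGroup Y] [InnerProductSpace ℝ Y]

/-- Feasible points. -/
def IsFeasible (p : ConicProblem X Y) (x : X) (y : Y) : Prop :=
  x ∈ p.K ∧ p.φ₁ x = 0 ∧ y ∈ p.L ∧ p.φ₂ y = 0

/-- Solutions, i.e. (global) minimizers. -/
def IsSolution (p : ConicProblem X Y) (x : X) (y : Y) : Prop :=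
  p.IsFeasible x y ∧ ∀ x' y', p.IsFeasible x' y' → p.Ψ (x, y) ≤ p.Ψ (x', y')

/-- Stationary points. Here `ProperCone.innerDual K` is the dual cone
`{ζ | ∀ x ∈ K, 0 ≤ ⟪x, ζ⟫}`, and `∇` is the gradient (the partial gradients of `Ψ` are the
gradients of its partial functions). -/
def IsStationary [FiniteDimensional ℝ X] [FiniteDimensional ℝ Y]
    (p : ConicProblem X Y) (x : X) (y : Y) : Prop :=
  ∃ γ₁ γ₂ : ℝ,
    (x ∈ p.K ∧
      inner ℝ x (∇ (fun x' => p.Ψ (x', y)) x + γ₁ • ∇ p.φ₁ x) = 0 ∧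
      ∇ (fun x' => p.Ψ (x', y)) x + γ₁ • ∇ p.φ₁ x ∈ ProperCone.innerDual p.K) ∧
    (y ∈ p.L ∧
      inner ℝ y (∇ (fun y' => p.Ψ (x, y')) y + γ₂ • ∇ p.φ₂ y) = 0 ∧
      ∇ (fun y' => p.Ψ (x, y')) y + γ₂ • ∇ p.φ₂ y ∈ ProperCone.innerDual p.L) ∧
    p.φ₁ x = 0 ∧ p.φ₂ y = 0

end ConicProblem

section Angles

variable {V : Type*} [NormedAddCommGroup V] [InnerProductSpace ℝ V]

theorem differentiableAt_norm_comp_sub_one {X : Type*} [NormedAddCommGroup X]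
    [InnerProductSpace ℝ X] [FiniteDimensional ℝ X] (G : X →ₗ[ℝ] V) (x : X)
    (hx : ‖G x‖ - 1 = 0) : DifferentiableAt ℝ (fun z => ‖G z‖ - 1) x := by
  have hG : DifferentiableAt ℝ (fun z => G z) x :=
    (LinearMap.toContinuousLinearMap G).differentiableAt
  have h0 : G x ≠ 0 := by
    intro h
    simp [h] at hx
  exact (hG.norm ℝ h0).sub_const 1

/-- The problem of minimizing `⟪u, v⟫` over the unit vectors `u ∈ P`, `v ∈ Q`. -/
noncomputable def maximalAngleProblem (P Q : ProperCone ℝ V) : ConicProblem V V where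
  K := P
  L := Q
  Ψ := fun p => inner ℝ p.1 p.2
  φ₁ := fun u => ‖u‖ - 1
  φ₂ := fun v => ‖v‖ - 1
  differentiableAt_Ψ := fun _ _ _ _ _ _ => differentiableAt_fst.inner ℝ differentiableAt_snd
  differentiableAt_φ₁ := fun u _ hu =>
    (differentiableAt_id.norm ℝ (by rintro rfl; simp at hu)).sub_const 1
  differentiableAt_φ₂ := fun v _ hv =>
    (differentiableAt_id.norm ℝ (by rintro rfl; simp at hv)).sub_const 1

/-- Antipodal pairs of `(P, Q)`. -/
def IsAntipodalPair (P Q : ProperCone ℝ V) (u v : V) : Prop :=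
  (maximalAngleProblem P Q).IsSolution u v

/-- Critical pairs of `(P, Q)`. -/
structure IsCriticalPair [FiniteDimensional ℝ V] (P Q : ProperCone ℝ V) (u v : V) : Prop where
  left_mem : u ∈ P
  norm_left : ‖u‖ = 1
  right_mem : v ∈ Q
  norm_right : ‖v‖ = 1
  left_dual : v - (inner ℝ u v : ℝ) • u ∈ ProperCone.innerDual (P : Set V)
  right_dual : u - (inner ℝ u v : ℝ) • v ∈ ProperCone.innerDual (Q : Set V)

variable {X Y : Type*} [NormedAddCommGroup X] [InnerProductSpace ℝ X] [FiniteDimensional ℝ X]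
  [NormedAddCommGroup Y] [InnerProductSpace ℝ Y] [FiniteDimensional ℝ Y]
  [EuclideanJordanAlgebra X] [EuclideanJordanAlgebra Y]

/-- The problem of minimizing `⟪G x, H y⟫` over the points `x`, `y` of the symmetric cones of `X`
and `Y` with `‖G x‖ = 1` and `‖H y‖ = 1`. -/
noncomputable def liftedAngleProblem (G : X →ₗ[ℝ] V) (H : Y →ₗ[ℝ] V) : ConicProblem X Y where
  K := symmetricCone X
  L := symmetricCone Y
  Ψ := fun p => inner ℝ (G p.1) (H p.2)
  φ₁ := fun x => ‖G x‖ - 1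
  φ₂ := fun y => ‖H y‖ - 1
  differentiableAt_Ψ := fun x _ y _ _ _ =>
    ((LinearMap.toContinuousLinearMap G).differentiableAt.comp (x, y) differentiableAt_fst).inner ℝ
      ((LinearMap.toContinuousLinearMap H).differentiableAt.comp (x, y) differentiableAt_snd)
  differentiableAt_φ₁ := fun x _ hx => differentiableAt_norm_comp_sub_one G x hx
  differentiableAt_φ₂ := fun y _ hy => differentiableAt_norm_comp_sub_one H y hy

end Angles

end ConeAngles

open ConeAngles InnerProductSpace

section Gradients

variable {V X : Type*} [NormedAddCommGroup V] [InnerProductSpace ℝ V] [FiniteDimensional ℝ V]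
  [NormedAddCommGroup X] [InnerProductSpace ℝ X] [FiniteDimensional ℝ X]

/-! Objective and constraints see `(x, y)` only through `(G x, H y)`, and `G`, `H` map the symmetric
cones onto `P`, `Q`. Hence minimizers correspond directly (`isSolution_liftedAngleProblem_iff`). For
stationarity, every gradient in the `x`-block lies in the range of the adjoint `G*`. Dual membership
descends to `V`, since `G* w` is in the dual of the symmetric cone iff `w` is in the dual of `P`,
and orthogonality to `x` determines the multiplier; likewise for `y`. What remains is the definition
of a critical pair (`isStationary_liftedAngleProblem_iff`). -/

theorem gradient_inner_linearMap_left (G : X →ₗ[ℝ] V) (w : V) (x : X) :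
    ∇ (fun z => (inner ℝ (G z) w : ℝ)) x = LinearMap.adjoint G w := by
  have h : (fun z => (inner ℝ (G z) w : ℝ)) = toDual ℝ X (LinearMap.adjoint G w) := by
    ext z
    rw [toDual_apply_apply, LinearMap.adjoint_inner_left, real_inner_comm]
  rw [h]
  exact HasGradientAt.gradient (hasGradientAt_iff_hasFDerivAt.2 (toDual ℝ X _).hasFDerivAt)

theorem gradient_inner_linearMap_right (G : X →ₗ[ℝ] V) (w : V) (x : X) :
    ∇ (fun z => (inner ℝ w (G z) : ℝ)) x = LinearMap.adjoint G w := by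
  simp_rw [real_inner_comm _ w]
  exact gradient_inner_linearMap_left G w x

theorem gradient_norm_linearMap_sub_one (G : X →ₗ[ℝ] V) (x : X) (hx : ‖G x‖ = 1) :
    ∇ (fun z => ‖G z‖ - 1) x = LinearMap.adjoint G (G x) := by
  have hG : HasFDerivAt (fun z => G z) (LinearMap.toContinuousLinearMap G) x :=
    (LinearMap.toContinuousLinearMap G).hasFDerivAt
  -- Write the norm as the root of its square; the factor `1 / ‖G x‖` produced by the chain rule is
  -- 1 at a unit vector.
  have h := (hG.norm_sq.sqrt (by simp [hx])).sub_const 1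
  simp only [Real.sqrt_sq (norm_nonneg _), hx] at h
  refine HasGradientAt.gradient (hasGradientAt_iff_hasFDerivAt.2 (h.congr_fderiv ?_))
  ext z
  simp [LinearMap.adjoint_inner_left]

end Gradients

namespace ConeAngles

variable {V X Y : Type*} [NormedAddCommGroup V] [InnerProductSpace ℝ V]
  [NormedAddCommGroup X] [InnerProductSpace ℝ X] [FiniteDimensional ℝ X]
  [NormedAddCommGroup Y] [InnerProductSpace ℝ Y] [FiniteDimensional ℝ Y]
  [EuclideanJordanAlgebra X] [EuclideanJordanAlgebra Y]

theorem IsLISC.mem_iff {P : ProperCone ℝ V} {G : X →ₗ[ℝ] V} (hP : IsLISC P G) {u : V} :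
    u ∈ P ↔ ∃ x ∈ symmetricCone X, G x = u := by
  rw [← SetLike.mem_coe, ← hP.image_eq, Set.mem_image]

theorem IsLISC.map_mem {P : ProperCone ℝ V} {G : X →ₗ[ℝ] V} (hP : IsLISC P G) {x : X}
    (hx : x ∈ symmetricCone X) : G x ∈ P :=
  hP.mem_iff.2 ⟨x, hx, rfl⟩

/-- Since `⟪x, G* w⟫ = ⟪G x, w⟫`, testing `G* w` on the symmetric cone is testing `w` on its image
`P`. -/
theorem IsLISC.adjoint_mem_innerDual_iff [FiniteDimensional ℝ V] {P : ProperCone ℝ V}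
    {G : X →ₗ[ℝ] V} (hP : IsLISC P G) (w : V) :
    LinearMap.adjoint G w ∈ ProperCone.innerDual (symmetricCone X) ↔
      w ∈ ProperCone.innerDual (P : Set V) := by
  simp only [ProperCone.mem_innerDual, LinearMap.adjoint_inner_right, ← hP.image_eq,
    Set.forall_mem_image]

theorem isSolution_liftedAngleProblem_iff {P Q : ProperCone ℝ V} {G : X →ₗ[ℝ] V} {H : Y →ₗ[ℝ] V}
    (hP : IsLISC P G) (hQ : IsLISC Q H) {x : X} {y : Y} (hx : x ∈ symmetricCone X)
    (hy : y ∈ symmetricCone Y) :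
    (liftedAngleProblem G H).IsSolution x y ↔ IsAntipodalPair P Q (G x) (H y) := by
  constructor
  · rintro ⟨⟨-, hx1, -, hy1⟩, hmin⟩
    refine ⟨⟨hP.map_mem hx, hx1, hQ.map_mem hy, hy1⟩, ?_⟩
    rintro u v ⟨hu, hu1, hv, hv1⟩
    obtain ⟨x', hx', rfl⟩ := hP.mem_iff.1 hu
    obtain ⟨y', hy', rfl⟩ := hQ.mem_iff.1 hv
    exact hmin x' y' ⟨hx', hu1, hy', hv1⟩
  · rintro ⟨⟨-, hx1, -, hy1⟩, hmin⟩
    refine ⟨⟨hx, hx1, hy, hy1⟩, ?_⟩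
    rintro x' y' ⟨hx', hx1', hy', hy1'⟩
    exact hmin (G x') (H y') ⟨hP.map_mem hx', hx1', hQ.map_mem hy', hy1'⟩

/-- At a unit vector `u = G x`, complementarity of `x` and `G* (w + γ u)` forces `γ = -⟪u, w⟫`. -/
theorem IsLISC.complementarity_iff [FiniteDimensional ℝ V] {P : ProperCone ℝ V}
    {G : X →ₗ[ℝ] V} (hP : IsLISC P G) {x : X} (hx : ‖G x‖ = 1) (w : V) (γ : ℝ) :
    (inner ℝ x (LinearMap.adjoint G w + γ • LinearMap.adjoint G (G x)) = 0 ∧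
      LinearMap.adjoint G w + γ • LinearMap.adjoint G (G x) ∈
        ProperCone.innerDual (symmetricCone X)) ↔
    γ = -inner ℝ (G x) w ∧
      w - (inner ℝ (G x) w : ℝ) • G x ∈ ProperCone.innerDual (P : Set V) := by
  -- The pairing with `x` becomes `⟪G x, w⟫ + γ ‖G x‖²`, and the normalization makes the coefficient
  -- of `γ` equal to 1.
  rw [← map_smul, ← map_add, LinearMap.adjoint_inner_right, hP.adjoint_mem_innerDual_iff,
    inner_add_right, real_inner_smul_right, real_inner_self_eq_norm_sq, hx, one_pow, mul_one,
    add_comm, ← eq_neg_iff_add_eq_zero]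
  refine and_congr_right fun h => ?_
  rw [h, neg_smul, sub_eq_add_neg, add_comm]

/-- The two blocks are treated separately by `IsLISC.complementarity_iff`, with `w = H y` for `x`
and `w = G x` for `y`. -/
theorem isStationary_liftedAngleProblem_iff [FiniteDimensional ℝ V] {P Q : ProperCone ℝ V}
    {G : X →ₗ[ℝ] V} {H : Y →ₗ[ℝ] V} (hP : IsLISC P G) (hQ : IsLISC Q H) {x : X} {y : Y}
    (hx : x ∈ symmetricCone X) (hy : y ∈ symmetricCone Y) :
    (liftedAngleProblem G H).IsStationary x y ↔ IsCriticalPair P Q (G x) (H y) := by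
  simp only [ConicProblem.IsStationary, liftedAngleProblem, gradient_inner_linearMap_left,
    gradient_inner_linearMap_right]
  constructor
  · rintro ⟨γ₁, γ₂, ⟨-, h₁⟩, ⟨-, h₂⟩, hx1, hy1⟩
    rw [sub_eq_zero] at hx1 hy1
    rw [gradient_norm_linearMap_sub_one G x hx1, hP.complementarity_iff hx1] at h₁
    rw [gradient_norm_linearMap_sub_one H y hy1, hQ.complementarity_iff hy1,
      real_inner_comm] at h₂
    exact ⟨hP.map_mem hx, hx1, hQ.map_mem hy, hy1, h₁.2, h₂.2⟩
  · rintro ⟨-, hx1, -, hy1, h₁, h₂⟩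
    rw [← real_inner_comm] at h₂
    -- These are the only multipliers that orthogonality allows.
    refine ⟨-inner ℝ (G x) (H y), -inner ℝ (H y) (G x), ⟨hx, ?_⟩, ⟨hy, ?_⟩,
      sub_eq_zero.2 hx1, sub_eq_zero.2 hy1⟩
    · rw [gradient_norm_linearMap_sub_one G x hx1, hP.complementarity_iff hx1]
      exact ⟨rfl, h₁⟩
    · rw [gradient_norm_linearMap_sub_one H y hy1, hQ.complementarity_iff hy1]
      exact ⟨rfl, h₂⟩

end ConeAngles

theorem proposition3p4
    {V X Y : Type*}
    [NormedAddCommGroup V] [InnerProductSpace ℝ V] [FiniteDimensional ℝ V]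
    [NormedAddCommGroup X] [InnerProductSpace ℝ X] [FiniteDimensional ℝ X]
    [NormedAddCommGroup Y] [InnerProductSpace ℝ Y] [FiniteDimensional ℝ Y]
    [ConeAngles.EuclideanJordanAlgebra X] [ConeAngles.EuclideanJordanAlgebra Y]
    (P Q : ProperCone ℝ V)
    (hP_ne_zero : (P : Set V) ≠ {0}) (hP_ne_univ : (P : Set V) ≠ Set.univ)
    (hQ_ne_zero : (Q : Set V) ≠ {0}) (hQ_ne_univ : (Q : Set V) ≠ Set.univ)
    (G : X →ₗ[ℝ] V) (H : Y →ₗ[ℝ] V)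
    (hP : ConeAngles.IsLISC P G) (hQ : ConeAngles.IsLISC Q H) :
    (∀ (x : X) (y : Y), (ConeAngles.liftedAngleProblem G H).IsStationary x y →
      ConeAngles.IsCriticalPair P Q (G x) (H y)) ∧
    (∀ (x : X) (y : Y), (ConeAngles.liftedAngleProblem G H).IsSolution x y →
      ConeAngles.IsAntipodalPair P Q (G x) (H y)) ∧
    (∀ u v : V, ConeAngles.IsCriticalPair P Q u v →
      ∃ (x : X) (y : Y), (ConeAngles.liftedAngleProblem G H).IsStationary x y ∧
        u = G x ∧ v = H y) ∧
    (∀ u v : V, ConeAngles.IsAntipodalPair P Q u v →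
      ∃ (x : X) (y : Y), (ConeAngles.liftedAngleProblem G H).IsSolution x y ∧
        u = G x ∧ v = H y) := by
  refine ⟨fun x y h => ?_, fun x y h => ?_, fun u v h => ?_, fun u v h => ?_⟩
  · have ⟨_, _, hx, hy, _⟩ := h
    exact (ConeAngles.isStationary_liftedAngleProblem_iff hP hQ hx.1 hy.1).1 h
  · exact (ConeAngles.isSolution_liftedAngleProblem_iff hP hQ h.1.1 h.1.2.2.1).1 h
  -- Any preimages in the symmetric cones will do, as the equivalence holds for all of them.
  · obtain ⟨x, hx, rfl⟩ := hP.mem_iff.1 h.left_mem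
    obtain ⟨y, hy, rfl⟩ := hQ.mem_iff.1 h.right_mem
    exact ⟨x, y, (ConeAngles.isStationary_liftedAngleProblem_iff hP hQ hx hy).2 h, rfl, rfl⟩
  · obtain ⟨x, hx, rfl⟩ := hP.mem_iff.1 h.1.1
    obtain ⟨y, hy, rfl⟩ := hQ.mem_iff.1 h.1.2.2.1
    exact ⟨x, y, (ConeAngles.isSolution_liftedAngleProblem_iff hP hQ hx hy).2 h, rfl, rfl⟩
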